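/- Let $n\ge 1$ be an integer and let $d\ge 2$ be an even integer. Let $\mathcal F_{d,n}$ be the space of real homogeneous polynomials (forms) of degree $d$ in $n$ variables, including $0$. For $f\in\mathcal F_{d,n}$ let $v(f)\in[0,+\infty]$ denote the Lebesgue volume of the sublevel set $\{x\in\mathbb R^n : f(x)\le 1\}$. Write $$f(x)=\sum_{|\alpha|=d} f_\alpha \sqrt{\binom{d}{\alpha}}\,x^\alpha,\qquad \binom{d}{\alpha}=\frac{d!}{\alpha_1!\cdots\alpha_n!},$$ and define the Bombieri norm of $f$ by $\|f\|_B=\bigl(\sum_{|\alpha|=d} f_\alpha^2\bigr)^{1/2}$. Let $b_{d,n}(x)=(x_1^2+\cdots+x_n^2)^{d/2}$. Then the form $b_{d,n}/\|b_{d,n}\|_B\in\mathcal F_{d,n}$ has Bombieri norm $1$, and for every $f\in\mathcal F_{d,n}$ with $\|f\|_B\le 1$, $$v\!\left(\frac{b_{d,n}}{\|b_{d,n}\|_B}\right)=\left(\prod_{i=0}^{d/2-1}\frac{2i+n}{2i+1}\right)^{\frac{n}{2d}}\frac{\pi^{n/2}}{\Gamma\left(\frac n2+1\right)}\;\le\;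 v(f),$$ with equality $v(f)=v\bigl(b_{d,n}/\|b_{d,n}\|_B\bigr)$ if and only if $f=b_{d,n}/\|b_{d,n}\|_B$. -/

import Mathlib

open MeasureTheory

noncomputable section

namespace BombieriForms

/-- The sublevel set `{f ≤ 1}` of a real polynomial in `n` variables, as a subset of Euclidean
space. -/
def sublevelSet {n : ℕ} (f : MvPolynomial (Fin n) ℝ) : Set (EuclideanSpace ℝ (Fin n)) :=
  {x | MvPolynomial.eval (fun i => x i) f ≤ 1}

/-- `v(f)`: the Lebesgue volume of `{f ≤ 1}`, possibly infinite. -/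
def sublevelVolume {n : ℕ} (f : MvPolynomial (Fin n) ℝ) : ENNReal :=
  volume (sublevelSet f)

/-- The coordinate `f_α` of `f` in the basis of rescaled monomials
`√(|α|! / (α₁! ⋯ αₙ!)) * x ^ α`. -/
def rescaledCoeff {n : ℕ} (f : MvPolynomial (Fin n) ℝ) (α : Fin n →₀ ℕ) : ℝ :=
  MvPolynomial.coeff α f / √(Nat.multinomial Finset.univ α : ℝ)

/-- The Bombieri norm of a form `f` of degree `d`: the square root of the sum of `f_α ^ 2` over all
exponents `α` with `|α| = d`. -/
def bombieriNorm {n : ℕ} (d : ℕ) (f : MvPolynomial (Fin n) ℝ) : ℝ :=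
  √(∑ α ∈ Finset.finsuppAntidiag (Finset.univ : Finset (Fin n)) d, rescaledCoeff f α ^ 2)

/-- `b_{d,n} = (x₁² + ⋯ + xₙ²)^(d/2)`, used for even `d`. -/
def euclideanForm (d n : ℕ) : MvPolynomial (Fin n) ℝ :=
  (∑ i, MvPolynomial.X i ^ 2) ^ (d / 2)

/-- `b_{d,n} / ‖b_{d,n}‖_B`. -/
def normalizedEuclideanForm (d n : ℕ) : MvPolynomial (Fin n) ℝ :=
  (bombieriNorm d (euclideanForm d n))⁻¹ • euclideanForm d n

/-- The number
`(∏_{i=0}^{d/2-1} (2i+n)/(2i+1))^(n/(2d)) * (√π)^n / Γ(n/2+1)`. -/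
def minimalVolume (d n : ℕ) : ℝ :=
  (∏ i ∈ Finset.range (d / 2), (2 * (i : ℝ) + (n : ℝ)) / (2 * (i : ℝ) + 1)) ^
      ((n : ℝ) / (2 * (d : ℝ))) *
    (√Real.pi ^ n / Real.Gamma ((n : ℝ) / 2 + 1))

end BombieriForms

end

namespace BombieriForms

/-! ### Sublevel sets and integrals of homogeneous functions -/

section Cone

open Set Module
open scoped Pointwise

variable {E : Type*} [NormedAddCommGroup E] [NormedSpace ℝ E] [MeasurableSpace E] [BorelSpace E]
  [FiniteDimensional ℝ E] {μ : Measure E} [μ.IsAddHaarMeasure] {F G : E → ℝ} {d : ℕ}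

/-! Let `g` be the normalized Euclidean form, `K = {g ≤ 1}`, and suppose `v(f) ≤ v(g)`. By
homogeneity and the layer-cake formula, `∫ (1 - f)⁺ = c * v(f)` with `c` depending only on the
degree and the dimension. Hence `∫_K (1 - f) ≤ ∫ (1 - f)⁺ ≤ ∫ (1 - g)⁺ = ∫_K (1 - g)`, that is `∫_K
g ≤ ∫_K f` (`setIntegral_le_of_measure_sublevel_le`).

Since `K` is a ball, polar coordinates turn this into an inequality between integrals over the unit
sphere, and then between Gaussian integrals. The Gaussian integral of a form is a fixed positive
multiple of its Bombieri product with `b_{d,n}` (`integral_eval_mul_exp`). So `1 = ⟨g, g⟩ ≤ ⟨f, g⟩`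
while `‖f‖_B ≤ 1`, and the equality case of Cauchy-Schwarz gives `f = g`. Both minimality and
uniqueness follow from this implication. -/

lemma measure_sublevel_of_homogeneous (hd : d ≠ 0)
    (hF : ∀ r : ℝ, 0 < r → ∀ x, F (r • x) = r ^ d * F x) {s : ℝ} (hs : 0 < s) :
    μ {x | F x ≤ s} = ENNReal.ofReal (s ^ ((finrank ℝ E : ℝ) / d)) * μ {x | F x ≤ 1} := by
  have hr : 0 < s ^ ((d : ℝ)⁻¹) := Real.rpow_pos_of_pos hs _
  have hset : {x | F x ≤ s} = s ^ ((d : ℝ)⁻¹) • {x | F x ≤ 1} := by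
    ext x
    rw [Set.mem_smul_set_iff_inv_smul_mem₀ hr.ne', mem_ofPred_eq, mem_ofPred_eq,
      hF _ (inv_pos.2 hr), inv_pow, Real.rpow_inv_natCast_pow hs.le hd, inv_mul_le_iff₀ hs, mul_one]
  rw [hset, Measure.addHaar_smul, abs_of_pos (pow_pos hr _), ← Real.rpow_natCast,
    ← Real.rpow_mul hs.le, inv_mul_eq_div]

/-- The set `{F ≤ 0}` is invariant under doubling, which multiplies its finite measure by `2 ^
finrank ℝ E > 1`. -/
lemma measure_nonpos_of_homogeneous [Nontrivial E]
    (hF : ∀ r : ℝ, 0 < r → ∀ x, F (r • x) = r ^ d * F x) (hfin : μ {x | F x ≤ 1} ≠ ⊤) :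
    μ {x | F x ≤ 0} = 0 := by
  have hset : (2 : ℝ) • {x | F x ≤ 0} = {x | F x ≤ 0} := by
    ext x
    rw [Set.mem_smul_set_iff_inv_smul_mem₀ two_ne_zero, mem_ofPred_eq, mem_ofPred_eq,
      hF _ (by norm_num)]
    constructor
    · intro h
      by_contra! h'
      exact absurd h (not_le.2 (by positivity))
    · exact fun h => mul_nonpos_of_nonneg_of_nonpos (by positivity) h
  have hlt : μ {x | F x ≤ 0} ≠ ⊤ :=
    ne_top_of_le_ne_top hfin (measure_mono fun x (hx : F x ≤ 0) => (hx.trans zero_le_one : F x ≤ 1))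
  have h := Measure.addHaar_smul μ (2 : ℝ) {x | F x ≤ 0}
  rw [hset, abs_of_pos (by positivity)] at h
  have h2 := congrArg ENNReal.toReal h
  rw [ENNReal.toReal_mul, ENNReal.toReal_ofReal (by positivity)] at h2
  have h3 : (1 : ℝ) < 2 ^ finrank ℝ E := one_lt_pow₀ (by norm_num) finrank_pos.ne'
  have h4 : (μ {x | F x ≤ 0}).toReal = 0 := by
    have : ((2 : ℝ) ^ finrank ℝ E - 1) * (μ {x | F x ≤ 0}).toReal = 0 := by linarith
    exact (mul_eq_zero.1 this).resolve_left (by linarith)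
  exact (ENNReal.toReal_eq_zero_iff _).1 h4 |>.resolve_right hlt

/-- Layer-cake formula: the level sets of `(1 - F)⁺` are the sets `{F ≤ 1 - t}`, whose measures
scale with that of `{F ≤ 1}`. The factor in front is the same for every `F` of degree `d`, so
measures of sublevel sets can be compared through these integrals. -/
lemma lintegral_one_sub_of_homogeneous [Nontrivial E] (hd : d ≠ 0) (hFm : Measurable F)
    (hF : ∀ r : ℝ, 0 < r → ∀ x, F (r • x) = r ^ d * F x) (hfin : μ {x | F x ≤ 1} ≠ ⊤) :
    ∫⁻ x, ENNReal.ofReal (1 - F x) ∂μ =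
      (∫⁻ t in Ioo (0 : ℝ) 1, ENNReal.ofReal ((1 - t) ^ ((finrank ℝ E : ℝ) / d))) *
        μ {x | F x ≤ 1} := by
  have h0 := measure_nonpos_of_homogeneous hF hfin
  have h1 : ∫⁻ x, ENNReal.ofReal (1 - F x) ∂μ = ∫⁻ x, ENNReal.ofReal (max (1 - F x) 0) ∂μ := by
    simp
  rw [h1, lintegral_eq_lintegral_meas_le μ (f := fun x => max (1 - F x) 0)
    (ae_of_all _ fun x => le_max_right _ _) (by fun_prop)]
  have h2 : ∀ t ∈ Ioi (0 : ℝ), μ {x | t ≤ max (1 - F x) 0} =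
      (Ioo (0 : ℝ) 1).indicator
        (fun t => ENNReal.ofReal ((1 - t) ^ ((finrank ℝ E : ℝ) / d)) * μ {x | F x ≤ 1}) t := by
    intro t ht
    rw [mem_Ioi] at ht
    have hset : {x | t ≤ max (1 - F x) 0} = {x | F x ≤ 1 - t} := by
      ext x
      simp only [mem_ofPred_eq, le_max_iff, not_le.2 ht, or_false]
      constructor <;> intro h <;> linarith
    rw [hset]
    by_cases ht1 : t < 1
    · rw [indicator_of_mem (show t ∈ Ioo (0 : ℝ) 1 from ⟨ht, ht1⟩), measure_sublevel_of_homogeneous hd hF (by linarith)]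
    -- For `t ≥ 1` the level set lies in the null set `{F ≤ 0}`.
    · rw [indicator_of_notMem (fun h : t ∈ Ioo (0 : ℝ) 1 => ht1 h.2)]
      refine measure_mono_null (fun x hx => ?_) h0
      simp only [mem_ofPred_eq] at hx ⊢
      linarith
  rw [setLIntegral_congr_fun measurableSet_Ioi h2, lintegral_indicator measurableSet_Ioo,
    Measure.restrict_restrict measurableSet_Ioo, inter_eq_left.2 (fun x hx => hx.1),
    lintegral_mul_const _ (by fun_prop)]

lemma setIntegral_le_of_measure_sublevel_le [Nontrivial E] (hd : d ≠ 0)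
    (hFc : Continuous F) (hF : ∀ r : ℝ, 0 < r → ∀ x, F (r • x) = r ^ d * F x)
    (hGc : Continuous G) (hG : ∀ r : ℝ, 0 < r → ∀ x, G (r • x) = r ^ d * G x)
    (hGK : IsCompact {x | G x ≤ 1}) (h : μ {x | F x ≤ 1} ≤ μ {x | G x ≤ 1}) :
    ∫ x in {x | G x ≤ 1}, G x ∂μ ≤ ∫ x in {x | G x ≤ 1}, F x ∂μ := by
  have hGfin : μ {x | G x ≤ 1} ≠ ⊤ := hGK.measure_lt_top.ne
  have hFfin : μ {x | F x ≤ 1} ≠ ⊤ := ne_top_of_le_ne_top hGfin h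
  have hle : ∫⁻ x, ENNReal.ofReal (1 - F x) ∂μ ≤ ∫⁻ x, ENNReal.ofReal (1 - G x) ∂μ := by
    rw [lintegral_one_sub_of_homogeneous hd hFc.measurable hF hFfin,
      lintegral_one_sub_of_homogeneous hd hGc.measurable hG hGfin]
    gcongr
  have hmeas : MeasurableSet {x | G x ≤ 1} := hGK.isClosed.measurableSet
  have hFi : IntegrableOn F {x | G x ≤ 1} μ := hFc.continuousOn.integrableOn_compact hGK
  have hGi : IntegrableOn G {x | G x ≤ 1} μ := hGc.continuousOn.integrableOn_compact hGK
  have hone : IntegrableOn (fun _ : E => (1 : ℝ)) {x | G x ≤ 1} μ :=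
    continuous_const.continuousOn.integrableOn_compact hGK
  have hGeq : ∫⁻ x, ENNReal.ofReal (1 - G x) ∂μ =
      ENNReal.ofReal (∫ x in {x | G x ≤ 1}, (1 - G x) ∂μ) := by
    rw [ofReal_integral_eq_lintegral_ofReal (f := fun x => 1 - G x) (hone.sub hGi)
      ((ae_restrict_iff' hmeas).2 (ae_of_all _ fun x hx => sub_nonneg.2 hx)),
      ← lintegral_indicator hmeas]
    refine lintegral_congr fun x => ?_
    by_cases hx : G x ≤ 1
    · rw [indicator_of_mem (by exact hx)]
    · rw [indicator_of_notMem (by exact hx), ENNReal.ofReal_of_nonpos (by linarith)]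
  -- For `F` only an inequality survives: `1 - F` may be negative on `{G ≤ 1}`, and its positive
  -- part may have mass outside.
  have hFle : ENNReal.ofReal (∫ x in {x | G x ≤ 1}, (1 - F x) ∂μ) ≤
      ∫⁻ x, ENNReal.ofReal (1 - F x) ∂μ := by
    calc ENNReal.ofReal (∫ x in {x | G x ≤ 1}, (1 - F x) ∂μ)
        ≤ ENNReal.ofReal (∫ x in {x | G x ≤ 1}, max (1 - F x) 0 ∂μ) := by
          refine ENNReal.ofReal_le_ofReal (integral_mono (hone.sub hFi) ?_ fun x => le_max_left _ _)
          exact (hone.sub hFi).pos_part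
      _ = ∫⁻ x in {x | G x ≤ 1}, ENNReal.ofReal (max (1 - F x) 0) ∂μ :=
          ofReal_integral_eq_lintegral_ofReal (hone.sub hFi).pos_part
            (ae_of_all _ fun x => le_max_right _ _)
      _ ≤ ∫⁻ x, ENNReal.ofReal (max (1 - F x) 0) ∂μ := setLIntegral_le_lintegral _ _
      _ = _ := by simp
  have hnn : 0 ≤ ∫ x in {x | G x ≤ 1}, (1 - G x) ∂μ :=
    setIntegral_nonneg hmeas fun x hx => sub_nonneg.2 hx
  have hfinal := (ENNReal.ofReal_le_ofReal_iff hnn).1 (hFle.trans (hle.trans hGeq.le))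
  rw [integral_sub hone hFi, integral_sub hone hGi] at hfinal
  linarith

/-- The integral of a homogeneous function against a radial weight splits in polar coordinates. -/
lemma integral_homogeneous_mul_radial [Nontrivial E]
    (hF : ∀ r : ℝ, 0 < r → ∀ x, F (r • x) = r ^ d * F x) (φ : ℝ → ℝ) :
    ∫ x, F x * φ ‖x‖ ∂μ = (∫ u, F u ∂μ.toSphere) *
      ∫ r in Ioi (0 : ℝ), r ^ (finrank ℝ E - 1 + d) * φ r := by
  calc
    ∫ x, F x * φ ‖x‖ ∂μ = ∫ x : ({(0)}ᶜ : Set E), F x * φ ‖x.1‖ ∂(μ.comap (↑)) := by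
      rw [integral_subtype_comap (measurableSet_singleton _).compl fun x ↦ F x * φ ‖x‖,
        restrict_compl_singleton]
    _ = ∫ p, F p.1 * ((p.2 : ℝ) ^ d * φ p.2)
          ∂μ.toSphere.prod (.volumeIoiPow (finrank ℝ E - 1)) := by
      rw [← μ.measurePreserving_homeomorphUnitSphereProd.integral_comp
        (Homeomorph.measurableEmbedding _)]
      refine integral_congr_ae (ae_of_all _ fun x => ?_)
      have hx : 0 < ‖x.1‖ := norm_pos_iff.2 x.2
      have := hF _ (inv_pos.2 hx) x.1
      simp only [homeomorphUnitSphereProd_apply_snd_coe, homeomorphUnitSphereProd_apply_fst_coe]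
      rw [this, inv_pow]
      field_simp
    _ = (∫ u, F u ∂μ.toSphere) *
          ∫ r : Ioi (0 : ℝ), (r : ℝ) ^ d * φ r ∂.volumeIoiPow (finrank ℝ E - 1) :=
      integral_prod_mul (fun u : Metric.sphere (0 : E) 1 => F u)
        (fun r : Ioi (0 : ℝ) => (r : ℝ) ^ d * φ r)
    _ = _ := by
      congr 1
      simp only [Measure.volumeIoiPow, ENNReal.ofReal]
      rw [integral_withDensity_eq_integral_smul,
        integral_subtype_comap measurableSet_Ioi
          fun a ↦ Real.toNNReal (a ^ (finrank ℝ E - 1)) • (a ^ d * φ a),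
        setIntegral_congr_fun measurableSet_Ioi fun x hx ↦ ?_]
      · rw [NNReal.smul_def, Real.coe_toNNReal _ (pow_nonneg (le_of_lt hx) _), smul_eq_mul,
          pow_add, mul_assoc]
      · exact (measurable_subtype_coe.pow_const _).real_toNNReal

end Cone

/-! ### Gaussian moments of monomials and of powers of the norm -/

section GaussianMoments

open Set Module

lemma integral_pow_mul_exp_neg_sq_Ioi (k : ℕ) :
    ∫ t in Ioi (0 : ℝ), t ^ k * Real.exp (-t ^ 2) = 1 / 2 * Real.Gamma ((k + 1) / 2) := by
  have h := integral_rpow_mul_exp_neg_rpow (p := 2) (q := k) two_pos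
    (lt_of_lt_of_le (by norm_num) k.cast_nonneg)
  rw [← h]
  refine setIntegral_congr_fun measurableSet_Ioi fun t _ => ?_
  simp only [Real.rpow_natCast, Real.rpow_two]

lemma integral_pow_mul_exp_neg_sq_of_odd {k : ℕ} (hk : Odd k) :
    ∫ t : ℝ, t ^ k * Real.exp (-t ^ 2) = 0 := by
  have h := integral_neg_eq_self (fun t : ℝ => t ^ k * Real.exp (-t ^ 2)) volume
  simp only [hk.neg_pow, neg_sq, neg_mul, integral_neg] at h
  linarith

lemma integral_pow_mul_exp_neg_sq_even (j : ℕ) :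
    ∫ t : ℝ, t ^ (2 * j) * Real.exp (-t ^ 2) =
      √Real.pi * ((2 * j).factorial / (4 ^ j * j.factorial)) := by
  have h := integral_comp_abs (f := fun t : ℝ => t ^ (2 * j) * Real.exp (-t ^ 2))
  simp only [(even_two_mul j).pow_abs, sq_abs] at h
  rw [h, integral_pow_mul_exp_neg_sq_Ioi]
  have hG : ∀ j : ℕ, Real.Gamma (j + 1 / 2) =
      √Real.pi * ((2 * j).factorial / (4 ^ j * j.factorial)) := by
    intro j
    induction j with
    | zero => simpa using Real.Gamma_one_half_eq
    | succ j ih =>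
      have : ((j + 1 : ℕ) : ℝ) + 1 / 2 = (j + 1 / 2) + 1 := by push_cast; ring
      rw [this, Real.Gamma_add_one (by positivity), ih, show 2 * (j + 1) = 2 * j + 1 + 1 by ring]
      simp only [Nat.factorial_succ]
      push_cast
      field_simp
      ring
  rw [← hG j]
  push_cast
  ring_nf

variable {n : ℕ}

lemma gaussianWeight_eq_prod (x : EuclideanSpace ℝ (Fin n)) :
    Real.exp (-‖x‖ ^ 2) = ∏ i, Real.exp (-x i ^ 2) := by
  rw [EuclideanSpace.real_norm_sq_eq, ← Real.exp_sum, Finset.sum_neg_distrib]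

lemma integral_prod_pow_mul_exp (α : Fin n → ℕ) :
    ∫ x : EuclideanSpace ℝ (Fin n), (∏ i, x i ^ α i) * Real.exp (-‖x‖ ^ 2) =
      ∏ i, ∫ t : ℝ, t ^ α i * Real.exp (-t ^ 2) := by
  simp only [gaussianWeight_eq_prod, ← Finset.prod_mul_distrib]
  rw [← integral_fintype_prod_volume_eq_prod (fun i (t : ℝ) => t ^ α i * Real.exp (-t ^ 2))]
  exact (PiLp.volume_preserving_ofLp (Fin n)).integral_comp
    (MeasurableEquiv.toLp 2 (Fin n → ℝ)).symm.measurableEmbedding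
    (fun y : Fin n → ℝ => ∏ i, (y i ^ α i * Real.exp (-y i ^ 2)))

lemma integrable_prod_pow_mul_exp (α : Fin n → ℕ) :
    Integrable fun x : EuclideanSpace ℝ (Fin n) =>
      (∏ i, x i ^ α i) * Real.exp (-‖x‖ ^ 2) := by
  simp only [gaussianWeight_eq_prod, ← Finset.prod_mul_distrib]
  refine ((PiLp.volume_preserving_ofLp (Fin n)).integrable_comp_emb
    (MeasurableEquiv.toLp 2 (Fin n → ℝ)).symm.measurableEmbedding
    (g := fun y : Fin n → ℝ => ∏ i, (y i ^ α i * Real.exp (-y i ^ 2)))).2 ?_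
  refine Integrable.fintype_prod (f := fun i (t : ℝ) => t ^ α i * Real.exp (-t ^ 2)) fun i => ?_
  have := integrable_rpow_mul_exp_neg_mul_sq one_pos (s := α i)
    (lt_of_lt_of_le (by norm_num) (α i).cast_nonneg)
  simpa using this

lemma integral_norm_pow_mul_exp [NeZero n] (m : ℕ) :
    ∫ x : EuclideanSpace ℝ (Fin n), ‖x‖ ^ (2 * m) * Real.exp (-‖x‖ ^ 2) =
      √Real.pi ^ n * ∏ i ∈ Finset.range m, ((n : ℝ) / 2 + i) := by
  have hn : 0 < n := NeZero.pos n
  -- The dependence on `m` is a single Gamma value, so the functional equation of `Gamma` drives the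
  -- induction. The volume of the unit ball is never evaluated: the case `m = 0`, a product of
  -- one-dimensional Gaussians, fixes the constant.
  have hrad : ∀ m : ℕ, ∫ x : EuclideanSpace ℝ (Fin n), ‖x‖ ^ (2 * m) * Real.exp (-‖x‖ ^ 2) =
      n * volume.real (Metric.ball (0 : EuclideanSpace ℝ (Fin n)) 1) *
        (1 / 2 * Real.Gamma ((n : ℝ) / 2 + m)) := by
    intro m
    rw [integral_fun_norm_addHaar volume (fun r => r ^ (2 * m) * Real.exp (-r ^ 2)),
      finrank_euclideanSpace_fin, nsmul_eq_mul, smul_eq_mul, mul_assoc]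
    simp only [smul_eq_mul, ← mul_assoc, ← pow_add]
    rw [integral_pow_mul_exp_neg_sq_Ioi]
    have : (((n - 1 + 2 * m : ℕ) : ℝ) + 1) / 2 = (n : ℝ) / 2 + m := by
      push_cast [Nat.cast_sub (show 1 ≤ n from hn)]
      ring
    rw [this]
    ring
  induction m with
  | zero =>
    have h := integral_prod_pow_mul_exp (n := n) 0
    have h0 := integral_pow_mul_exp_neg_sq_even 0
    simp at h h0
    simp [h, h0]
  | succ m ih =>
    rw [hrad] at ih ⊢
    rw [Finset.prod_range_succ, ← mul_assoc (√Real.pi ^ n), ← ih]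
    push_cast
    rw [← add_assoc, Real.Gamma_add_one (by positivity)]
    ring

end GaussianMoments

/-! ### Bombieri product and the Euclidean form -/

section BombieriProduct

open Finset

variable {n : ℕ}

/-- Substituting squares for variables reduces the coefficients to the multinomial theorem: they
vanish unless every exponent is even. -/
lemma euclideanForm_two_mul (m n : ℕ) :
    euclideanForm (2 * m) n = MvPolynomial.expand 2 ((∑ i, MvPolynomial.X i) ^ m) := by
  simp [euclideanForm]

lemma isHomogeneous_euclideanForm (m n : ℕ) : (euclideanForm (2 * m) n).IsHomogeneous (2 * m) := by
  rw [euclideanForm, Nat.mul_div_cancel_left _ two_pos]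
  exact (MvPolynomial.IsHomogeneous.sum _ _ _ fun i _ => MvPolynomial.isHomogeneous_X_pow i 2).pow m

lemma eval_euclideanForm (m : ℕ) (x : EuclideanSpace ℝ (Fin n)) :
    MvPolynomial.eval (fun i => x i) (euclideanForm (2 * m) n) = ‖x‖ ^ (2 * m) := by
  simp [euclideanForm, pow_mul, EuclideanSpace.real_norm_sq_eq]

/-- The proportionality factor between the Gaussian integral of a form of degree `2 * m` and its
Bombieri product with `euclideanForm`. -/
noncomputable def gaussianFactor (m n : ℕ) : ℝ := √Real.pi ^ n * ((2 * m).factorial / (4 ^ m * m.factorial))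

lemma gaussianFactor_pos (m n : ℕ) : 0 < gaussianFactor m n := by
  unfold gaussianFactor
  have := Real.pi_pos
  positivity

/-- Both sides vanish if some exponent is odd. For `α = 2 • β` the moments give `∏ (2 β i)! / (β
i)!` up to a power of `4`, which is the ratio of the multinomial coefficients of `β` and `2 • β`
times `(2 * m)! / m!`. -/
lemma prod_gaussianMoment_eq (m : ℕ) (α : Fin n →₀ ℕ) (hα : ∑ i, α i = 2 * m) :
    ∏ i, ∫ t : ℝ, t ^ α i * Real.exp (-t ^ 2) =
      gaussianFactor m n * (MvPolynomial.coeff α (euclideanForm (2 * m) n) /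
        Nat.multinomial univ α) := by
  rw [euclideanForm_two_mul]
  by_cases hodd : ∃ i, Odd (α i)
  · obtain ⟨i, hi⟩ := hodd
    rw [prod_eq_zero (mem_univ i) (integral_pow_mul_exp_neg_sq_of_odd hi),
      MvPolynomial.coeff_expand_of_not_dvd (i := i)]
    · simp
    · rwa [← even_iff_two_dvd, Nat.not_even_iff_odd]
  · push Not at hodd
    obtain ⟨β, rfl⟩ : ∃ β : Fin n →₀ ℕ, α = 2 • β := by
      refine ⟨Finsupp.equivFunOnFinite.symm fun i => α i / 2, ?_⟩
      ext i
      have := hodd i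
      simp
      grind
    simp only [Finsupp.smul_apply, smul_eq_mul, ← mul_sum] at hα
    have hβ : ∑ i, β i = m := by omega
    rw [MvPolynomial.coeff_expand_smul 2 two_ne_zero, MvPolynomial.coeff_sum_X_pow_of_fintype,
      Finsupp.sum_fintype _ _ (by simp), if_pos hβ,
      Finsupp.multinomial_eq_of_support_subset (subset_univ _)]
    have h1 := Nat.multinomial_spec univ β
    have h2 := Nat.multinomial_spec univ (2 • ⇑β)
    rw [hβ] at h1
    simp only [Finsupp.coe_smul, Pi.smul_apply, smul_eq_mul, ← mul_sum, hβ] at h2 ⊢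
    simp only [integral_pow_mul_exp_neg_sq_even, prod_mul_distrib, prod_div_distrib, prod_const,
      card_univ, Fintype.card_fin, prod_pow_eq_pow_sum, hβ, gaussianFactor]
    rw [← h1, ← h2]
    have h3 : (Nat.multinomial univ (2 • ⇑β) : ℝ) ≠ 0 := by
      exact_mod_cast (Nat.multinomial_pos _ _).ne'
    have h4 : (Nat.multinomial univ ⇑β : ℝ) ≠ 0 := by
      exact_mod_cast (Nat.multinomial_pos _ _).ne'
    have h5 : ∏ i, ((β i).factorial : ℝ) ≠ 0 :=
      prod_ne_zero_iff.2 fun i _ => by positivity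
    push_cast
    field_simp

lemma sum_eq_of_mem_support {d : ℕ} {f : MvPolynomial (Fin n) ℝ} (hf : f.IsHomogeneous d)
    {α : Fin n →₀ ℕ} (hα : α ∈ f.support) : ∑ i, α i = d := by
  rw [← hf (MvPolynomial.mem_support_iff.1 hα), Finsupp.weight_apply,
    Finsupp.sum_fintype _ _ (by simp)]
  simp

/-- By linearity this reduces to monomials. It makes the Gaussian integral a linear functional
represented by `euclideanForm` in the Bombieri product. -/
lemma integral_eval_mul_exp {m : ℕ} {f : MvPolynomial (Fin n) ℝ} (hf : f.IsHomogeneous (2 * m)) :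
    ∫ x : EuclideanSpace ℝ (Fin n), MvPolynomial.eval (fun i => x i) f * Real.exp (-‖x‖ ^ 2) =
      gaussianFactor m n * ∑ α ∈ finsuppAntidiag (univ : Finset (Fin n)) (2 * m),
        rescaledCoeff f α * rescaledCoeff (euclideanForm (2 * m) n) α := by
  have hdeg := fun α hα => sum_eq_of_mem_support hf (α := α) hα
  have hsub : f.support ⊆ finsuppAntidiag (univ : Finset (Fin n)) (2 * m) := fun α hα =>
    mem_finsuppAntidiag.2 ⟨hdeg α hα, subset_univ _⟩
  simp only [MvPolynomial.eval_eq', sum_mul, mul_assoc]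
  rw [integral_finsetSum _ fun (α : Fin n →₀ ℕ) _ =>
    (integrable_prod_pow_mul_exp (⇑α)).const_mul (MvPolynomial.coeff α f), mul_sum]
  simp only [integral_const_mul, integral_prod_pow_mul_exp]
  rw [← sum_subset hsub fun α _ hα => ?_]
  · refine sum_congr rfl fun α hα => ?_
    rw [prod_gaussianMoment_eq m α (hdeg α hα), rescaledCoeff, rescaledCoeff, div_mul_div_comm,
      Real.mul_self_sqrt (Nat.cast_nonneg _)]
    ring
  · simp [rescaledCoeff, MvPolynomial.notMem_support_iff.1 hα]

lemma bombieriNorm_sq (d : ℕ) (f : MvPolynomial (Fin n) ℝ) :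
    bombieriNorm d f ^ 2 = ∑ α ∈ finsuppAntidiag (univ : Finset (Fin n)) d, rescaledCoeff f α ^ 2 :=
  Real.sq_sqrt (sum_nonneg fun _ _ => sq_nonneg _)

lemma rescaledCoeff_smul (c : ℝ) (f : MvPolynomial (Fin n) ℝ) (α : Fin n →₀ ℕ) :
    rescaledCoeff (c • f) α = c * rescaledCoeff f α := by
  simp [rescaledCoeff, mul_div_assoc]

lemma bombieriNorm_smul {c : ℝ} (hc : 0 ≤ c) (d : ℕ) (f : MvPolynomial (Fin n) ℝ) :
    bombieriNorm d (c • f) = c * bombieriNorm d f := by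
  simp only [bombieriNorm, rescaledCoeff_smul, mul_pow, ← mul_sum]
  rw [Real.sqrt_mul (sq_nonneg c), Real.sqrt_sq hc]

/-- The equality case of the Cauchy-Schwarz inequality in the unit ball of the Bombieri norm. -/
lemma eq_of_one_le_bombieriProduct {d : ℕ} {f g : MvPolynomial (Fin n) ℝ} (hf : f.IsHomogeneous d)
    (hg : g.IsHomogeneous d) (hf1 : bombieriNorm d f ≤ 1) (hg1 : bombieriNorm d g ≤ 1)
    (h : 1 ≤ ∑ α ∈ finsuppAntidiag (univ : Finset (Fin n)) d,
      rescaledCoeff f α * rescaledCoeff g α) : f = g := by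
  have hsq : ∀ {f : MvPolynomial (Fin n) ℝ}, bombieriNorm d f ≤ 1 →
      ∑ α ∈ finsuppAntidiag (univ : Finset (Fin n)) d, rescaledCoeff f α ^ 2 ≤ 1 := fun h =>
    bombieriNorm_sq d _ ▸ pow_le_one₀ (Real.sqrt_nonneg _) h
  -- Expanding the square, `‖f - g‖² = ‖f‖² - 2⟨f, g⟩ + ‖g‖² ≤ 1 - 2 + 1`.
  have hsum : ∑ α ∈ finsuppAntidiag (univ : Finset (Fin n)) d,
      (rescaledCoeff f α - rescaledCoeff g α) ^ 2 ≤ 0 := by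
    simp only [sub_sq, sum_add_distrib, sum_sub_distrib, mul_assoc, ← mul_sum]
    linarith [hsq hf1, hsq hg1]
  have hzero := (sum_eq_zero_iff_of_nonneg fun _ _ => sq_nonneg _).1
    (le_antisymm hsum (sum_nonneg fun _ _ => sq_nonneg _))
  ext α
  by_cases hα : ∑ i, α i = d
  · have h0 := hzero α (mem_finsuppAntidiag.2 ⟨hα, subset_univ _⟩)
    have hpos : 0 < √(Nat.multinomial univ α : ℝ) :=
      Real.sqrt_pos.2 (by exact_mod_cast Nat.multinomial_pos _ _)
    rw [sq_eq_zero_iff, sub_eq_zero, rescaledCoeff, rescaledCoeff, div_left_inj' hpos.ne'] at h0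
    exact h0
  · have hdeg : α.degree ≠ d := by rwa [Finsupp.degree_eq_sum]
    rw [hf.coeff_eq_zero hdeg, hg.coeff_eq_zero hdeg]

/-- The Gaussian integral of `‖x‖ ^ (2 * m)` is computed in two ways: radially, and as
`gaussianFactor` times the squared Bombieri norm. -/
lemma bombieriNorm_euclideanForm_sq [NeZero n] (m : ℕ) :
    bombieriNorm (2 * m) (euclideanForm (2 * m) n) ^ 2 =
      ∏ i ∈ range m, (2 * (i : ℝ) + n) / (2 * (i : ℝ) + 1) := by
  have h := integral_eval_mul_exp (isHomogeneous_euclideanForm m n)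
  simp only [eval_euclideanForm, ← sq] at h
  rw [← bombieriNorm_sq, integral_norm_pow_mul_exp] at h
  have hfac : ∀ m : ℕ, ((2 * m).factorial : ℝ) / (4 ^ m * m.factorial) =
      ∏ i ∈ range m, ((2 * (i : ℝ) + 1) / 2) := by
    intro m
    induction m with
    | zero => simp
    | succ m ih =>
      rw [prod_range_succ, ← ih, show 2 * (m + 1) = 2 * m + 1 + 1 by ring]
      simp only [Nat.factorial_succ]
      push_cast
      field_simp
      ring
  rw [gaussianFactor, hfac, mul_assoc] at h
  have hpi : √Real.pi ^ n ≠ 0 := pow_ne_zero _ (Real.sqrt_pos.2 Real.pi_pos).ne'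
  have h' := mul_left_cancel₀ hpi h
  have hpos : 0 < ∏ i ∈ range m, ((2 * (i : ℝ) + 1) / 2) := prod_pos fun i _ => by positivity
  rw [mul_comm, ← div_eq_iff hpos.ne'] at h'
  rw [← h', ← prod_div_distrib]
  refine prod_congr rfl fun i _ => ?_
  field_simp
  ring

lemma bombieriNorm_euclideanForm_pos [NeZero n] (m : ℕ) :
    0 < bombieriNorm (2 * m) (euclideanForm (2 * m) n) := by
  have hn : 0 < n := NeZero.pos n
  refine (Real.sqrt_nonneg _).lt_of_ne' fun h => ?_
  have h2 := bombieriNorm_euclideanForm_sq (n := n) m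
  rw [bombieriNorm, h] at h2
  exact absurd h2.symm (by
    rw [zero_pow two_ne_zero]
    exact (prod_pos fun i _ => by positivity).ne')

lemma isHomogeneous_normalizedEuclideanForm (m n : ℕ) :
    (normalizedEuclideanForm (2 * m) n).IsHomogeneous (2 * m) := by
  rw [normalizedEuclideanForm, MvPolynomial.smul_eq_C_mul]
  exact (isHomogeneous_euclideanForm m n).C_mul _

lemma bombieriNorm_normalizedEuclideanForm [NeZero n] (m : ℕ) :
    bombieriNorm (2 * m) (normalizedEuclideanForm (2 * m) n) = 1 := by
  have h := bombieriNorm_euclideanForm_pos (n := n) m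
  rw [normalizedEuclideanForm, bombieriNorm_smul (inv_nonneg.2 h.le), inv_mul_cancel₀ h.ne']

end BombieriProduct

/-! ### The minimal volume and uniqueness of the minimizer -/

section Minimizer

open Set Module

variable {n : ℕ}

lemma eval_smul_of_isHomogeneous {d : ℕ} {f : MvPolynomial (Fin n) ℝ} (hf : f.IsHomogeneous d)
    (r : ℝ) (x : EuclideanSpace ℝ (Fin n)) :
    MvPolynomial.eval (fun i => (r • x) i) f = r ^ d * MvPolynomial.eval (fun i => x i) f := by
  simp only [MvPolynomial.eval_eq', Finset.mul_sum]
  refine Finset.sum_congr rfl fun α hα => ?_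
  simp only [PiLp.smul_apply, smul_eq_mul, mul_pow, Finset.prod_mul_distrib,
    Finset.prod_pow_eq_pow_sum, sum_eq_of_mem_support hf hα]
  ring

lemma continuous_eval (f : MvPolynomial (Fin n) ℝ) :
    Continuous fun x : EuclideanSpace ℝ (Fin n) => MvPolynomial.eval (fun i => x i) f :=
  (MvPolynomial.continuous_eval f).comp (PiLp.continuous_ofLp 2 _)

lemma integral_eval_mul_radial [NeZero n] {d : ℕ} {f : MvPolynomial (Fin n) ℝ}
    (hf : f.IsHomogeneous d) (φ : ℝ → ℝ) :
    ∫ x : EuclideanSpace ℝ (Fin n), MvPolynomial.eval (fun i => x i) f * φ ‖x‖ =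
      (∫ u : Metric.sphere (0 : EuclideanSpace ℝ (Fin n)) 1,
        MvPolynomial.eval (fun i => u.1 i) f ∂(volume.toSphere)) *
      ∫ r in Ioi (0 : ℝ), r ^ (finrank ℝ (EuclideanSpace ℝ (Fin n)) - 1 + d) * φ r :=
  integral_homogeneous_mul_radial (μ := volume)
    (F := fun x : EuclideanSpace ℝ (Fin n) => MvPolynomial.eval (fun i => x i) f)
    (fun r _ x => eval_smul_of_isHomogeneous hf r x) φ

/-- The radius of the ball on which the normalized Euclidean form is at most `1`. -/
noncomputable def minimalRadius (m n : ℕ) : ℝ :=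
  bombieriNorm (2 * m) (euclideanForm (2 * m) n) ^ (((2 * m : ℕ) : ℝ)⁻¹)

lemma minimalRadius_pos [NeZero n] (m : ℕ) : 0 < minimalRadius m n :=
  Real.rpow_pos_of_pos (bombieriNorm_euclideanForm_pos m) _

lemma sublevelSet_normalizedEuclideanForm [NeZero n] {m : ℕ} (hm : m ≠ 0) :
    sublevelSet (normalizedEuclideanForm (2 * m) n) = Metric.closedBall 0 (minimalRadius m n) := by
  have hN := bombieriNorm_euclideanForm_pos (n := n) m
  ext x
  rw [mem_closedBall_zero_iff, sublevelSet, mem_ofPred_eq, normalizedEuclideanForm,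
    MvPolynomial.smul_eval, eval_euclideanForm, inv_mul_le_iff₀ hN, mul_one,
    ← pow_le_pow_iff_left₀ (norm_nonneg x) (minimalRadius_pos m).le
      (mul_ne_zero two_ne_zero hm), minimalRadius,
    Real.rpow_inv_natCast_pow hN.le (mul_ne_zero two_ne_zero hm)]

lemma sublevelVolume_normalizedEuclideanForm [NeZero n] {m : ℕ} (hm : m ≠ 0) :
    sublevelVolume (normalizedEuclideanForm (2 * m) n) =
      ENNReal.ofReal (minimalVolume (2 * m) n) := by
  have hN := bombieriNorm_euclideanForm_pos (n := n) m
  rw [sublevelVolume, sublevelSet_normalizedEuclideanForm hm, EuclideanSpace.volume_closedBall,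
    Fintype.card_fin, ← ENNReal.ofReal_pow (minimalRadius_pos m).le,
    ← ENNReal.ofReal_mul (pow_nonneg (minimalRadius_pos m).le _), minimalVolume,
    Nat.mul_div_cancel_left _ two_pos, ← bombieriNorm_euclideanForm_sq, minimalRadius,
    ← Real.rpow_natCast, ← Real.rpow_mul hN.le, ← Real.rpow_natCast _ 2, ← Real.rpow_mul hN.le]
  congr 3
  push_cast
  field_simp

/-- The core of the proof. The sublevel set of the Euclidean form being a ball, the volume
comparison depends on `f` only through its spherical mean, which is a Bombieri product. -/
lemma eq_normalizedEuclideanForm_of_sublevelVolume_le [NeZero n] {m : ℕ} (hm : m ≠ 0)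
    {f : MvPolynomial (Fin n) ℝ} (hf : f.IsHomogeneous (2 * m)) (hf1 : bombieriNorm (2 * m) f ≤ 1)
    (hvol : sublevelVolume f ≤ sublevelVolume (normalizedEuclideanForm (2 * m) n)) :
    f = normalizedEuclideanForm (2 * m) n := by
  have hN := bombieriNorm_euclideanForm_pos (n := n) m
  have hR := minimalRadius_pos (n := n) m
  have hg := isHomogeneous_normalizedEuclideanForm m n
  have hg1 := bombieriNorm_normalizedEuclideanForm (n := n) m
  have hset := sublevelSet_normalizedEuclideanForm (n := n) hm
  set g := normalizedEuclideanForm (2 * m) n with hgdef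
  have hball := setIntegral_le_of_measure_sublevel_le (μ := volume) (mul_ne_zero two_ne_zero hm)
    (continuous_eval f) (fun r _ x => eval_smul_of_isHomogeneous hf r x)
    (continuous_eval g) (fun r _ x => eval_smul_of_isHomogeneous hg r x)
    (by
      change IsCompact (sublevelSet g)
      rw [hset]
      exact isCompact_closedBall _ _) hvol
  change ∫ x in sublevelSet g, _ ≤ ∫ x in sublevelSet g, _ at hball
  -- The indicator of the ball is treated as a radial weight; its radial moment is positive, so it
  -- can be cancelled below.
  have hconst : ∫ r in Ioi (0 : ℝ), r ^ (finrank ℝ (EuclideanSpace ℝ (Fin n)) - 1 + 2 * m) *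
      (Iic (minimalRadius m n)).indicator 1 r =
        minimalRadius m n ^ (finrank ℝ (EuclideanSpace ℝ (Fin n)) - 1 + 2 * m + 1) /
          ((finrank ℝ (EuclideanSpace ℝ (Fin n)) - 1 + 2 * m : ℕ) + 1) := by
    have hind : ∀ r : ℝ, r ^ (finrank ℝ (EuclideanSpace ℝ (Fin n)) - 1 + 2 * m) *
        (Iic (minimalRadius m n)).indicator 1 r = (Iic (minimalRadius m n)).indicator
          (fun r => r ^ (finrank ℝ (EuclideanSpace ℝ (Fin n)) - 1 + 2 * m)) r := by
      simp [indicator]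
    simp only [hind]
    rw [setIntegral_indicator measurableSet_Iic, Ioi_inter_Iic,
      ← intervalIntegral.integral_of_le hR.le, integral_pow]
    simp
  have hpolar : ∀ {p : MvPolynomial (Fin n) ℝ}, p.IsHomogeneous (2 * m) →
      ∫ x in sublevelSet g, MvPolynomial.eval (fun i => x i) p =
        (∫ u : Metric.sphere (0 : EuclideanSpace ℝ (Fin n)) 1,
          MvPolynomial.eval (fun i => u.1 i) p ∂(volume.toSphere)) *
        (minimalRadius m n ^ (finrank ℝ (EuclideanSpace ℝ (Fin n)) - 1 + 2 * m + 1) /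
          ((finrank ℝ (EuclideanSpace ℝ (Fin n)) - 1 + 2 * m : ℕ) + 1)) := by
    intro p hp
    rw [← hconst, ← integral_eval_mul_radial hp, hset,
      ← integral_indicator Metric.isClosed_closedBall.measurableSet]
    refine integral_congr_ae (ae_of_all _ fun x => ?_)
    by_cases hx : ‖x‖ ≤ minimalRadius m n
    · simp [indicator, hx]
    · simp [indicator, hx]
  rw [hpolar hf, hpolar hg] at hball
  have hsphere := le_of_mul_le_mul_right hball (by positivity)
  -- Trading the ball for the Gaussian weight: both see a form only through its integral over the
  -- sphere.
  have hgauss := mul_le_mul_of_nonneg_right hsphere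
    (show 0 ≤ ∫ r in Ioi (0 : ℝ), r ^ (finrank ℝ (EuclideanSpace ℝ (Fin n)) - 1 + 2 * m) *
      Real.exp (-r ^ 2) from
      setIntegral_nonneg measurableSet_Ioi fun r hr =>
        mul_nonneg (pow_nonneg (le_of_lt hr) _) (Real.exp_nonneg _))
  rw [← integral_eval_mul_radial hg (fun r => Real.exp (-r ^ 2)),
    ← integral_eval_mul_radial hf (fun r => Real.exp (-r ^ 2)),
    integral_eval_mul_exp hg, integral_eval_mul_exp hf] at hgauss
  have hprod := le_of_mul_le_mul_left hgauss (gaussianFactor_pos m n)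
  have hb : ∀ α, rescaledCoeff (euclideanForm (2 * m) n) α =
      bombieriNorm (2 * m) (euclideanForm (2 * m) n) * rescaledCoeff g α := by
    intro α
    rw [hgdef, normalizedEuclideanForm, rescaledCoeff_smul, mul_inv_cancel_left₀ hN.ne']
  simp only [hb, mul_left_comm _ (bombieriNorm (2 * m) (euclideanForm (2 * m) n)),
    ← Finset.mul_sum, ← sq] at hprod
  have hle := le_of_mul_le_mul_left hprod hN
  rw [← bombieriNorm_sq, hg1, one_pow] at hle
  exact eq_of_one_le_bombieriProduct hf hg hf1 hg1.le hle

end Minimizer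

end BombieriForms

theorem mainTheorem3 (n d : ℕ) (hn : 1 ≤ n) (hd : 2 ≤ d) (hd_even : Even d) :
    (BombieriForms.normalizedEuclideanForm d n).IsHomogeneous d ∧
    BombieriForms.bombieriNorm d (BombieriForms.normalizedEuclideanForm d n) = 1 ∧
    BombieriForms.sublevelVolume (BombieriForms.normalizedEuclideanForm d n) =
      ENNReal.ofReal (BombieriForms.minimalVolume d n) ∧
    ∀ f : MvPolynomial (Fin n) ℝ, f.IsHomogeneous d → BombieriForms.bombieriNorm d f ≤ 1 →
      ENNReal.ofReal (BombieriForms.minimalVolume d n) ≤ BombieriForms.sublevelVolume f ∧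
      (BombieriForms.sublevelVolume f = ENNReal.ofReal (BombieriForms.minimalVolume d n) ↔
        f = BombieriForms.normalizedEuclideanForm d n) := by
  obtain ⟨m, rfl⟩ := hd_even.two_dvd
  have : NeZero n := ⟨by omega⟩
  have hm : m ≠ 0 := by omega
  have hvol := BombieriForms.sublevelVolume_normalizedEuclideanForm (n := n) hm
  refine ⟨BombieriForms.isHomogeneous_normalizedEuclideanForm m n,
    BombieriForms.bombieriNorm_normalizedEuclideanForm m, hvol, fun f hf hf1 => ?_⟩
  have key := BombieriForms.eq_normalizedEuclideanForm_of_sublevelVolume_le hm hf hf1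
  rw [← hvol]
  refine ⟨?_, fun h => key h.le, fun h => by rw [h]⟩
  -- A competitor of no larger volume must be the minimizer itself, so the lower bound follows from
  -- uniqueness.
  rcases le_total (BombieriForms.sublevelVolume f) (BombieriForms.sublevelVolume
    (BombieriForms.normalizedEuclideanForm (2 * m) n)) with h | h
  · exact (congrArg BombieriForms.sublevelVolume (key h)).ge
  · exact h
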